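/- For real numbers $t>0$, $c>0$ and $\beta\ge 0$ define \[ h(t,c,\beta)=4\int_{\min\{t,\beta\}}^{\beta}\frac{\min\{\tau-t,\,c\}}{c}\,d\tau , \] and, for $\theta\ge 0$, \[ g(t,c,\beta,\theta)= \begin{cases} 0 & \text{if } 0\le\theta<\max\{t,\beta\},\\[1ex] \displaystyle \frac{2\beta}{\theta}\cdot\frac{\min\{\theta-t,\,c\}}{c}-\int_t^{\theta}\frac{2\min\{\tau-t,\,c\}}{c\,\max\{\tau,\beta\}}\,d\tau & \text{otherwise.} \end{cases} \] Then for all real $t>0$, $c>0$ and $\beta\ge c/2$, the integral $\int_0^\infty e^{g(t,c,\beta,\theta)}\,d\theta$ converges, and \[ F(t,c,\beta)=4t+8\beta-2\int_0^\infty e^{g(t,c,\beta,\theta)}\,d\theta-h(t,c,\beta)\;\ge\;0 . \] -/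

import Mathlib

/-- The function `h(t, c, β) = 4 ∫_{min{t, β}}^{β} min{τ - t, c} / c dτ`. -/
noncomputable def balancedH (t c β : ℝ) : ℝ :=
  4 * ∫ τ in (min t β)..β, min (τ - t) c / c

/-- The exponent `g(t, c, β, θ)`, for `θ ≥ 0`. -/
noncomputable def balancedG (t c β θ : ℝ) : ℝ :=
  if θ < max t β then 0
  else (2 * β / θ) * (min (θ - t) c / c)
    - ∫ τ in t..θ, (2 * min (τ - t) c) / (c * max τ β)

/-- The function `F(t, c, β) = 4 t + 8 β - 2 ∫_0^∞ exp (g(t, c, β, θ)) dθ - h(t, c, β)`. -/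
noncomputable def balancedF (t c β : ℝ) : ℝ :=
  4 * t + 8 * β - 2 * (∫ θ in Set.Ioi (0 : ℝ), Real.exp (balancedG t c β θ)) - balancedH t c β

/-! The exponent g and the function h are homogeneous of degree 0 and 1, so F scales linearly and β
= 1, c ≤ 2 may be assumed. Put M = max t 1 and N = max (t + c) 1. On (0, M) the integrand is 1.
Beyond N the ramp is saturated and exp g is a constant times exp (2/θ) / θ², which has an elementary
antiderivative; this gives convergence and an exact tail. Only [M, N] needs an estimate, by a
function p - q (θ - M) (`integral_exp_balancedG_le`). What remains is an explicit inequality in t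
and c, in three regimes. If t + c ≤ 1, the middle piece is empty and convexity of exp suffices. If t
≥ 1, then h = 0; rational bounds for log give a constant bound in the middle and control the tail.
If t < 1 < t + c, set d = 1 - t and w = t + c - 1: a constant bound on [M, N] works for d ≤ 1/2, and
the tangent line of g at θ = 1 for d ≥ 1/2. There the middle and the tail together may cost at most
5 - 2d - d²/(d + w). -/

/-! ### Elementary bounds for exp and log. -/

/-- Term by term, x ^ (k + n) ≤ (x / y) ^ n * y ^ (k + n). Hence a Taylor bound checked numerically
at the single point y holds on all of [0, y]. -/
theorem exp_sub_taylor_le (n : ℕ) {x y : ℝ} (hx : 0 ≤ x) (hxy : x ≤ y) (hy : 0 < y) :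
    Real.exp x - ∑ i ∈ Finset.range n, x ^ i / (i.factorial : ℝ) ≤
      (x / y) ^ n * (Real.exp y - ∑ i ∈ Finset.range n, y ^ i / (i.factorial : ℝ)) := by
  have key : ∀ z : ℝ, HasSum (fun k => z ^ (k + n) / ((k + n).factorial : ℝ))
      (Real.exp z - ∑ i ∈ Finset.range n, z ^ i / (i.factorial : ℝ)) := fun z => by
    rw [hasSum_nat_add_iff' (f := fun k => z ^ k / (k.factorial : ℝ)) n, Real.exp_eq_exp_ℝ]
    exact NormedSpace.expSeries_div_hasSum_exp z
  refine hasSum_le (fun k => ?_) (key x) ((key y).mul_left _)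
  have h1 : (x / y) ^ n * (y ^ (k + n) / ((k + n).factorial : ℝ))
      = x ^ n * y ^ k / ((k + n).factorial : ℝ) := by
    rw [div_pow, pow_add]
    field_simp
  rw [h1, pow_add, mul_comm]
  gcongr

theorem exp_le_quadratic {x y k : ℝ} (hx : 0 ≤ x) (hxy : x ≤ y) (hy : 0 < y)
    (hk : Real.exp y ≤ 1 + y + k * y ^ 2) : Real.exp x ≤ 1 + x + k * x ^ 2 := by
  have h := exp_sub_taylor_le 2 hx hxy hy
  simp only [Finset.sum_range_succ, Finset.sum_range_zero] at h
  norm_num at h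
  have h2 : (x / y) ^ 2 * (Real.exp y - (1 + y)) ≤ (x / y) ^ 2 * (k * y ^ 2) := by
    gcongr; linarith
  have h3 : (x / y) ^ 2 * (k * y ^ 2) = k * x ^ 2 := by field_simp
  linarith

theorem exp_two_le : Real.exp 2 ≤ 7.3891 := by
  have h : Real.exp 2 = Real.exp 1 ^ 2 := by rw [← Real.exp_nat_mul]; norm_num
  rw [h]
  calc Real.exp 1 ^ 2 ≤ 2.7182818286 ^ 2 := by gcongr; exact Real.exp_one_lt_d9.le
    _ ≤ 7.3891 := by norm_num

theorem exp_le_cubic {x : ℝ} (hx : 0 ≤ x) (hx2 : x ≤ 2) :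
    Real.exp x ≤ 1 + x + x ^ 2 / 2 + 0.299 * x ^ 3 := by
  have h := exp_sub_taylor_le 3 hx hx2 two_pos
  simp only [Finset.sum_range_succ, Finset.sum_range_zero, Nat.factorial] at h
  norm_num at h
  -- The constant 0.299 rounds up (exp 2 - 5) / 8.
  have h2 : (x / 2) ^ 3 * (Real.exp 2 - 5) ≤ (x / 2) ^ 3 * 2.3892 := by
    gcongr; linarith [exp_two_le]
  nlinarith [pow_nonneg hx 3]

/-- Upper bounds for `exp (p / q)` from `exp 1 < 2.7182818286`. -/
theorem exp_div_le {p q : ℕ} (hq : q ≠ 0) {b : ℝ} (hb : 0 ≤ b)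
    (h : (2.7182818286 : ℝ) ^ p ≤ b ^ q) : Real.exp (p / q) ≤ b := by
  have hq' : (q : ℝ) ≠ 0 := by exact_mod_cast hq
  refine le_of_pow_le_pow_left₀ hq hb (le_trans ?_ h)
  have : Real.exp (p / q) ^ q = Real.exp 1 ^ p := by
    rw [← Real.exp_nat_mul, ← Real.exp_nat_mul]
    congr 1
    rw [mul_div_cancel₀ _ hq', mul_one]
  rw [this]
  gcongr
  exact Real.exp_one_lt_d9.le

/-- The right side is the [2/1] Padé approximant of log at 1; the difference has derivative (y - 1)³
/ (y (2y + 1)²) ≥ 0. -/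
theorem log_le_pade {x : ℝ} (hx : 1 ≤ x) :
    Real.log x ≤ (x - 1) * (x + 5) / (4 * x + 2) := by
  let f : ℝ → ℝ := fun x => (x - 1) * (x + 5) / (4 * x + 2) - Real.log x
  have hd : ∀ y : ℝ, 1 ≤ y → HasDerivAt f ((y - 1) ^ 3 / (y * (2 * y + 1) ^ 2)) y := by
    intro y hy
    have h1 : HasDerivAt (fun x : ℝ => (x - 1) * (x + 5)) (1 * (y + 5) + (y - 1) * 1) y :=
      ((hasDerivAt_id y).sub_const 1).mul ((hasDerivAt_id y).add_const 5)
    have h2 : HasDerivAt (fun x : ℝ => 4 * x + 2) (4 * 1) y :=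
      ((hasDerivAt_id y).const_mul 4).add_const 2
    refine ((h1.div h2 (by linarith)).sub (Real.hasDerivAt_log (by linarith))).congr_deriv ?_
    have : y ≠ 0 := by linarith
    have : 2 * y + 1 ≠ 0 := by linarith
    have : 4 * y + 2 ≠ 0 := by linarith
    field_simp
    ring
  have hm : MonotoneOn f (Set.Ici 1) := by
    refine monotoneOn_of_deriv_nonneg (convex_Ici 1)
      (fun y hy => (hd y hy).continuousAt.continuousWithinAt)
      (fun y hy => ?_) (fun y hy => ?_)
    · rw [interior_Ici] at hy
      exact (hd y (le_of_lt hy)).differentiableAt.differentiableWithinAt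
    · rw [interior_Ici] at hy
      have hy' : 1 < y := hy
      rw [(hd y hy'.le).deriv]
      have : 0 < y - 1 := by linarith
      positivity
  have h := hm (Set.mem_Ici.2 le_rfl) (Set.mem_Ici.2 hx) hx
  simp only [f] at h
  norm_num at h
  linarith

theorem log_le_half_sub_inv {x : ℝ} (hx : 1 ≤ x) :
    Real.log x ≤ (x ^ 2 - 1) / (2 * x) := by
  refine (log_le_pade hx).trans ?_
  rw [div_le_div_iff₀ (by linarith) (by linarith)]
  nlinarith [pow_nonneg (sub_nonneg.2 hx) 3]

theorem exp_neg_le {d : ℝ} (h0 : 0 ≤ d) (h1 : d ≤ 1) :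
    Real.exp (-d) ≤ 1 - 0.9 * d + 0.28 * d ^ 2 := by
  have h := Real.sum_le_exp_of_nonneg h0 4
  simp only [Finset.sum_range_succ, Finset.sum_range_zero, Nat.factorial] at h
  norm_num at h
  have hq : 0 < 1 - 0.9 * d + 0.28 * d ^ 2 := by nlinarith
  rw [Real.exp_neg, inv_le_comm₀ (Real.exp_pos d) hq]
  refine le_trans ?_ h
  rw [inv_le_iff_one_le_mul₀ hq]
  -- The quadratic times the cubic Taylor polynomial of exp d is at least 1 + d times this
  -- polynomial, whose coefficients are slightly rounded down.
  have h2 : 0 ≤ 0.1 - 0.12 * d - 0.004 * d ^ 2 - 0.01 * d ^ 3 + 0.046 * d ^ 4 := by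
    nlinarith [sq_nonneg (d ^ 2 - 0.8), sq_nonneg (d - 0.9), mul_nonneg h0 (sub_nonneg.2 h1),
      pow_nonneg h0 2, pow_nonneg h0 3, sq_nonneg (d * (d - 0.9))]
  nlinarith [mul_nonneg h0 h2, pow_nonneg h0 2, pow_nonneg h0 3,pow_nonneg h0 4,pow_nonneg h0 5]

theorem tail_factor_le {w : ℝ} (h0 : 0 ≤ w) (h2 : w ≤ 2) :
    (2 + w + 1.196 / (1 + w)) * Real.exp (-(0.4 * w)) ≤ 3.2 - 0.6 * w := by
  have h := Real.sum_le_exp_of_nonneg (x := 0.4 * w) (by positivity) 4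
  simp only [Finset.sum_range_succ, Finset.sum_range_zero, Nat.factorial] at h
  norm_num at h
  rw [Real.exp_neg, ← div_eq_mul_inv, div_le_iff₀ (Real.exp_pos _)]
  have hs : 0 ≤ 3.2 - 0.6 * w := by linarith
  have h3 := mul_le_mul_of_nonneg_left h hs
  norm_num at h3 ⊢
  refine le_trans ?_ h3
  have hw : 0 < 1 + w := by linarith
  have : 2 + w + 299 / 250 / (1 + w) = ((2 + w) * (1 + w) + 1.196) / (1 + w) := by
    field_simp; ring
  rw [this, div_le_iff₀ hw]
  have e1 := mul_nonneg h0 (sub_nonneg.2 h2)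
  nlinarith [e1, mul_nonneg e1 h0, mul_nonneg (mul_nonneg e1 h0) h0,
    mul_nonneg (mul_nonneg (mul_nonneg e1 h0) h0) h0]

/-! ### Polynomial inequalities left after clearing denominators. -/

/-- This is w (1 + k + K k²) ≤ 1.75 - 0.55 d + 0.5 w for k = (0.54 + 0.86 d²) / (d + w), multiplied
by (d + w)². Since d ≤ 1/2, replacing 0.86 d² by 0.43 d lowers the degree. -/
theorem cubic_poly_bound_of_le_one {d w : ℝ} (hd : 0 ≤ d) (hd2 : d ≤ 1 / 2) (hw : 0.3 ≤ w)
    (hw1 : w ≤ 1) :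
    w * ((d + w) ^ 2 + (0.54 + 0.86 * d ^ 2) * (d + w) + 1.004 * (0.54 + 0.86 * d ^ 2) ^ 2) ≤
      (1.75 - 0.55 * d + 0.5 * w) * (d + w) ^ 2 := by
  have hk : 0.86 * d ^ 2 ≤ 0.43 * d := by nlinarith
  have h1 : w * ((d + w) ^ 2 + (0.54 + 0.86 * d ^ 2) * (d + w) +
      1.004 * (0.54 + 0.86 * d ^ 2) ^ 2) ≤
      w * ((d + w) ^ 2 + (0.54 + 0.43 * d) * (d + w) + 1.004 * (0.54 + 0.43 * d) ^ 2) := by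
    have : 0 ≤ w := by linarith
    have : 0 ≤ d + w := by linarith
    gcongr
  refine h1.trans ?_
  have a := sub_nonneg.2 hd2
  have b := sub_nonneg.2 hw
  have e := sub_nonneg.2 hw1
  nlinarith [mul_nonneg hd a, mul_nonneg hd b, mul_nonneg hd e, mul_nonneg a b, mul_nonneg a e,
    mul_nonneg b e, mul_nonneg (mul_nonneg hd a) b, mul_nonneg (mul_nonneg hd a) e,
    mul_nonneg (mul_nonneg hd b) e, mul_nonneg (mul_nonneg a b) e,
    mul_nonneg (mul_nonneg b b) e, mul_nonneg (mul_nonneg b e) e]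

theorem cubic_poly_bound_of_one_le {d w : ℝ} (hd : 0 ≤ d) (hd2 : d ≤ 1 / 2) (hw : 1 ≤ w)
    (hw1 : w ≤ 2 - d) :
    w * ((d + w) ^ 2 + (0.54 + 0.86 * d ^ 2) * (d + w) + 0.61 * (0.54 + 0.86 * d ^ 2) ^ 2) ≤
      (1.75 - 0.55 * d + 0.5 * w) * (d + w) ^ 2 := by
  have hk : 0.86 * d ^ 2 ≤ 0.43 * d := by nlinarith
  have h1 : w * ((d + w) ^ 2 + (0.54 + 0.86 * d ^ 2) * (d + w) +
      0.61 * (0.54 + 0.86 * d ^ 2) ^ 2) ≤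
      w * ((d + w) ^ 2 + (0.54 + 0.43 * d) * (d + w) + 0.61 * (0.54 + 0.43 * d) ^ 2) := by
    have : 0 ≤ w := by linarith
    have : 0 ≤ d + w := by linarith
    gcongr
  refine h1.trans ?_
  have a := sub_nonneg.2 hd2
  have b := sub_nonneg.2 hw
  have e := sub_nonneg.2 hw1
  nlinarith [mul_nonneg hd a, mul_nonneg hd b, mul_nonneg hd e, mul_nonneg a b, mul_nonneg a e,
    mul_nonneg b e, mul_nonneg (mul_nonneg hd a) b, mul_nonneg (mul_nonneg hd a) e,
    mul_nonneg (mul_nonneg hd b) e, mul_nonneg (mul_nonneg a b) e,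
    mul_nonneg (mul_nonneg b b) e, mul_nonneg (mul_nonneg b e) e]

theorem quartic_poly_bound {d w : ℝ} (hd : 1 / 2 ≤ d) (hd2 : d ≤ 1) (hw : 0 ≤ w) (hw1 : w ≤ 2 - d) :
    ((d + w) ^ 2 + (2 * d - d ^ 2) * (d + w) + 0.882 * (2 * d - d ^ 2) ^ 2) *
        (w * (d + w - 0.31 * (4 * d - 2) * w)) ≤ (2.1 - 1.35 * d + 0.57 * w) * (d + w) ^ 3 := by
  obtain ⟨a, rfl⟩ : ∃ a, d = 1 - a := ⟨1 - d, by ring⟩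
  have a0 : 0 ≤ a := by linarith
  have a1 : 0 ≤ 1 / 2 - a := by linarith
  have ha : 0 < 1 + a := by linarith
  have ab := mul_nonneg a0 a1
  have hA : (2 * (1 - a) - (1 - a) ^ 2) ^ 2 ≤ 1 - 7 / 4 * a ^ 2 := by
    nlinarith [mul_nonneg ab (mul_nonneg a0 (by linarith : 0 ≤ 1 / 2 + a))]
  have hG : 0 ≤ w * (1 - a + w - 0.31 * (4 * (1 - a) - 2) * w) := by
    apply mul_nonneg hw; nlinarith
  have h3 : (1 - a + w) ^ 2 + (2 * (1 - a) - (1 - a) ^ 2) * (1 - a + w) +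
      0.882 * (2 * (1 - a) - (1 - a) ^ 2) ^ 2 ≤
      (1 - a + w) ^ 2 + (2 * (1 - a) - (1 - a) ^ 2) * (1 - a + w) + 0.882 * (1 - 7 / 4 * a ^ 2) := by
    linarith
  refine (mul_le_mul_of_nonneg_right h3 hG).trans ?_
  -- Rescaling w to v in [0, 1] allows a Bernstein expansion of degree 4 in v; `q0` to `q4` are its
  -- coefficients, binomial factors included, each nonnegative for a in [0, 1/2].
  obtain ⟨v, rfl⟩ : ∃ v, w = v * (1 + a) := ⟨w / (1 + a), by field_simp⟩
  have v0 : 0 ≤ v := nonneg_of_mul_nonneg_left hw ha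
  have v1 : 0 ≤ 1 - v := sub_nonneg.2 (le_of_mul_le_mul_right (by linarith) ha)
  have a2 := pow_nonneg a0 2
  have a3 := pow_nonneg a0 3
  have q0 : 0 ≤ (3 / 4) + (-9 / 10) * a + (-9 / 5) * a ^ 2 + (33 / 10) * a ^ 3 +
      (-27 / 20) * a ^ 4 := by
    nlinarith [ab, mul_nonneg ab a0, mul_nonneg ab a2, mul_nonneg ab a3, mul_nonneg ab ab,
      mul_nonneg ab (mul_nonneg a2 a2)]
  have q1 : 0 ≤ (1469 / 500) + (3 / 50) * a + (-18149 / 2000) * a ^ 2 + (427 / 50) * a ^ 3 +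
      (-6927 / 2000) * a ^ 4 + a ^ 5 := by
    nlinarith [ab, mul_nonneg ab a0, mul_nonneg ab a2, mul_nonneg ab a3, mul_nonneg ab ab,
      mul_nonneg ab (mul_nonneg a2 a2)]
  have q2 : 0 ≤ (104471 / 25000) + (782 / 125) * a + (-1369949 / 100000) * a ^ 2 +
      (230833 / 25000) * a ^ 3 + (-149609 / 100000) * a ^ 4 + (52697 / 50000) * a ^ 5 +
      (-31 / 25) * a ^ 6 := by
    nlinarith [ab, mul_nonneg ab a0, mul_nonneg ab a2, mul_nonneg ab a3, mul_nonneg ab ab,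
      mul_nonneg ab (mul_nonneg a2 a2)]
  have q3 : 0 ≤ (8949 / 3125) + (1843 / 250) * a + (-262887 / 25000) * a ^ 2 +
      (115333 / 12500) * a ^ 3 + (149729 / 12500) * a ^ 4 + (142197 / 25000) * a ^ 5 +
      (-31 / 25) * a ^ 6 := by
    nlinarith [ab, mul_nonneg ab a0, mul_nonneg ab a2, mul_nonneg ab a3, mul_nonneg ab ab,
      mul_nonneg ab (mul_nonneg a2 a2)]
  have q4 : 0 ≤ (26571 / 25000) + (399 / 250) * a + (-791049 / 100000) * a ^ 2 +
      (-36167 / 25000) * a ^ 3 + (659091 / 100000) * a ^ 4 + (219697 / 50000) * a ^ 5 := by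
    nlinarith [ab, mul_nonneg ab a0, mul_nonneg ab a2, mul_nonneg ab a3, mul_nonneg ab ab,
      mul_nonneg ab (mul_nonneg a2 a2)]
  linear_combination mul_nonneg q0 (pow_nonneg v1 4) +
    mul_nonneg q1 (mul_nonneg v0 (pow_nonneg v1 3)) +
    mul_nonneg q2 (mul_nonneg (pow_nonneg v0 2) (pow_nonneg v1 2)) +
    mul_nonneg q3 (mul_nonneg (pow_nonneg v0 3) v1) + mul_nonneg q4 (pow_nonneg v0 4)

theorem quartic_tail_bound {c r : ℝ} (hc : 0 < c) (hc2 : c ≤ 2) (hr : 0 ≤ r) :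
    2 * ((1 + c + r) ^ 2 + (1 + c + r) + 1.196) * (3 * (1 + c + r) - c) ^ 2 ≤
      (1 + c + r) * ((1 + c + r) + 2.25 - 1.5 * c) *
        (2 * (3 * (1 + c + r) - c) ^ 2 + 2 * (3 * c) * (3 * (1 + c + r) - c) + (3 * c) ^ 2) := by
  have h := mul_nonneg hc.le (sub_nonneg.2 hc2)
  have h2 := sub_nonneg.2 hc2
  have h1 := hc.le
  nlinarith [h, mul_nonneg h h1, mul_nonneg h h, mul_nonneg h hr, mul_nonneg (mul_nonneg h h1) hr,
    mul_nonneg (mul_nonneg h hr) hr, mul_nonneg hr h2, mul_nonneg (mul_nonneg hr hr) h2,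
    mul_nonneg (pow_nonneg hr 3) h2, mul_nonneg (mul_nonneg h h) hc.le,
    mul_nonneg (mul_nonneg h h) hr]

/-! ### Numerical bounds for the middle piece and the total budget. -/

/-- The bound by 0.54 + 0.86 d² degenerates as d + w tends to 0, so 2 / (1 + w) is used for w ≤ 0.3.
Beyond that, exp is replaced by a quadratic with constant fitted at the largest possible k: 1.8 for
w ≤ 1 and 0.54 for w ≥ 1. -/
theorem mul_exp_le_of_le_half {d w y : ℝ} (hd : 0 ≤ d) (hd2 : d ≤ 1 / 2) (hw : 0 ≤ w)
    (hdw : w ≤ 2 - d) (hy : y ≤ 2 / (1 + w)) (hy2 : (d + w) * y ≤ 0.54 + 0.86 * d ^ 2) :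
    w * Real.exp y ≤ 1.75 - 0.55 * d + 0.5 * w := by
  rcases le_total w 0.21 with h | h
  · have h1 : Real.exp y ≤ 7.3891 := by
      refine le_trans (Real.exp_le_exp.2 (hy.trans ?_)) exp_two_le
      rw [div_le_iff₀ (by linarith)]; linarith
    nlinarith
  rcases le_total w 0.3 with h' | h'
  · have h1 : Real.exp y ≤ 5.23 := by
      have := exp_div_le (p := 200) (q := 121) (b := 5.23) (by norm_num) (by norm_num)
        (by norm_num)
      refine le_trans (Real.exp_le_exp.2 (hy.trans ?_)) this
      rw [div_le_iff₀ (by linarith)]; push_cast; linarith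
    nlinarith
  have hc : 0 < d + w := by linarith
  set k := (0.54 + 0.86 * d ^ 2) / (d + w) with hk
  have hyk : y ≤ k := by rw [hk, le_div_iff₀ hc]; linarith
  have hk0 : 0 ≤ k := by positivity
  have hkc : k * (d + w) = 0.54 + 0.86 * d ^ 2 := by rw [hk]; field_simp
  suffices hs : w * Real.exp k ≤ 1.75 - 0.55 * d + 0.5 * w from
    (mul_le_mul_of_nonneg_left (Real.exp_le_exp.2 hyk) hw).trans hs
  have fin : ∀ K : ℝ, Real.exp k ≤ 1 + k + K * k ^ 2 →
      w * ((d + w) ^ 2 + (0.54 + 0.86 * d ^ 2) * (d + w) + K * (0.54 + 0.86 * d ^ 2) ^ 2) ≤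
        (1.75 - 0.55 * d + 0.5 * w) * (d + w) ^ 2 →
      w * Real.exp k ≤ 1.75 - 0.55 * d + 0.5 * w := by
    intro K h1 h2
    refine (mul_le_mul_of_nonneg_left h1 hw).trans ?_
    refine le_of_mul_le_mul_right ?_ (pow_pos hc 2)
    refine le_trans (le_of_eq ?_) h2
    rw [← hkc]; ring
  rcases le_total w 1 with hw1 | hw1
  · refine fin 1.004 (exp_le_quadratic (y := 1.8) hk0 ?_ (by norm_num) ?_) ?_
    · rw [hk, div_le_iff₀ hc]; nlinarith
    · have := exp_div_le (p := 9) (q := 5) (b := 6.0498) (by norm_num) (by norm_num)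
        (by norm_num)
      norm_num at this ⊢; linarith
    · exact cubic_poly_bound_of_le_one hd hd2 h' hw1
  · refine fin 0.61 (exp_le_quadratic (y := 0.54) hk0 ?_ (by norm_num) ?_) ?_
    · rw [hk, div_le_iff₀ hc]; nlinarith
    · have := exp_div_le (p := 27) (q := 50) (b := 1.717) (by norm_num) (by norm_num)
        (by norm_num)
      norm_num at this ⊢; linarith
    · exact cubic_poly_bound_of_one_le hd hd2 hw1 hdw

theorem mul_exp_le_of_half_le {d w : ℝ} (hd : 1 / 2 ≤ d) (hd2 : d ≤ 1) (hw : 0 ≤ w)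
    (hdw : w ≤ 2 - d) :
    Real.exp ((2 * d - d ^ 2) / (d + w)) * (w - 0.31 * ((4 * d - 2) / (d + w)) * w ^ 2) ≤
      2.1 - 1.35 * d + 0.57 * w := by
  have hc : 0 < d + w := by linarith
  set k := (2 * d - d ^ 2) / (d + w) with hk
  have hkc : k * (d + w) = 2 * d - d ^ 2 := by rw [hk]; field_simp
  have hk0 : 0 ≤ k := by rw [hk]; apply div_nonneg <;> nlinarith
  have h1 : Real.exp k ≤ 1 + k + 0.882 * k ^ 2 := by
    refine exp_le_quadratic (y := 1.5) hk0 ?_ (by norm_num) ?_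
    · rw [hk, div_le_iff₀ hc]; nlinarith
    · have := exp_div_le (p := 3) (q := 2) (b := 4.482) (by norm_num) (by norm_num)
        (by norm_num)
      norm_num at this ⊢; linarith
  have h2 : 0 ≤ w - 0.31 * ((4 * d - 2) / (d + w)) * w ^ 2 := by
    have : w - 0.31 * ((4 * d - 2) / (d + w)) * w ^ 2
      = w * (d + w - 0.31 * (4 * d - 2) * w) / (d + w) := by field_simp
    rw [this]
    apply div_nonneg _ hc.le
    apply mul_nonneg hw; nlinarith
  refine (mul_le_mul_of_nonneg_right h1 h2).trans ?_
  refine le_of_mul_le_mul_right ?_ (pow_pos hc 3)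
  have : (1 + k + 0.882 * k ^ 2) * (w - 0.31 * ((4 * d - 2) / (d + w)) * w ^ 2) * (d + w) ^ 3
      = ((d + w) ^ 2 + (2 * d - d ^ 2) * (d + w) + 0.882 * (2 * d - d ^ 2) ^ 2) *
        (w * (d + w - 0.31 * (4 * d - 2) * w)) := by
    rw [← hkc]; field_simp
  rw [this]
  exact quartic_poly_bound hd hd2 hw hdw

theorem budget_of_le_half {d w : ℝ} (hd : 0 ≤ d) (hd2 : d ≤ 1 / 2) (hw : 0 < w)
    (hdw : w ≤ 2 - d) :
    1.75 - 0.55 * d + 0.5 * w + (1 - 0.9 * d + 0.28 * d ^ 2) * (3.2 - 0.6 * w) ≤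
      5 - 2 * d - d ^ 2 / (d + w) := by
  have hc : 0 < d + w := by linarith
  -- d - d²/(d + w) = d w / (d + w), and d + w ≤ 2.
  have h : d ^ 2 / (d + w) ≤ d - d * w / 2 := by
    rw [div_le_iff₀ hc]
    nlinarith [mul_nonneg (mul_nonneg hd hw.le) (sub_nonneg.2 hdw)]
  nlinarith [mul_nonneg hd hw.le, mul_nonneg hd (sub_nonneg.2 hd2),
    mul_nonneg (mul_nonneg hd hw.le) (sub_nonneg.2 hd2)]

theorem budget_of_half_le {d w : ℝ} (hd : 1 / 2 ≤ d) (hd2 : d ≤ 1) (hw : 0 < w)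
    (hdw : w ≤ 2 - d) :
    2.1 - 1.35 * d + 0.57 * w + (1 - 0.9 * d + 0.28 * d ^ 2) * (3.2 - 0.6 * w) ≤
      5 - 2 * d - d ^ 2 / (d + w) := by
  have hc : 0 < d + w := by linarith
  have h : d ^ 2 / (d + w) ≤ d - d * w / 2 := by
    rw [div_le_iff₀ hc]
    nlinarith [mul_nonneg (mul_nonneg (by linarith : 0 ≤ d) hw.le) (sub_nonneg.2 hdw)]
  nlinarith [mul_nonneg (sub_nonneg.2 hd) hw.le, mul_nonneg (sub_nonneg.2 hd) (sub_nonneg.2 hd2),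
    mul_nonneg (sub_nonneg.2 hd2) hw.le, mul_nonneg hw.le (sub_nonneg.2 hdw),
    mul_nonneg (mul_nonneg (sub_nonneg.2 hd) hw.le) (sub_nonneg.2 hd2)]

theorem tail_le_of_one_le {T c D : ℝ} (hc : 0 < c) (hc2 : c ≤ 2) (hT : 1 + c ≤ T)
    (hD : 3 * c / (3 * T - c) ≤ D) :
    (T + 1 + 1.196 / T) * Real.exp (-D) ≤ T + 2.25 - 1.5 * c := by
  have hT0 : 0 < T := by linarith
  have hq : 0 < 3 * T - c := by linarith
  set E := 3 * c / (3 * T - c) with hE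
  have hE0 : 0 ≤ E := by positivity
  have hEq : E * (3 * T - c) = 3 * c := by rw [hE]; field_simp
  have h1 : (1 + E + E ^ 2 / 2) ≤ Real.exp D :=
    (Real.quadratic_le_exp_of_nonneg hE0).trans (Real.exp_le_exp.2 hD)
  rw [Real.exp_neg, ← div_eq_mul_inv, div_le_iff₀ (Real.exp_pos _)]
  refine le_trans ?_ (mul_le_mul_of_nonneg_left h1 (by linarith))
  refine le_of_mul_le_mul_right ?_ (by positivity : 0 < 2 * T * (3 * T - c) ^ 2)
  have e1 : (T + 1 + 1.196 / T) * (2 * T * (3 * T - c) ^ 2)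
      = 2 * (T ^ 2 + T + 1.196) * (3 * T - c) ^ 2 := by field_simp
  have e2 : (T + 2.25 - 1.5 * c) * (1 + E + E ^ 2 / 2) * (2 * T * (3 * T - c) ^ 2)
      = T * (T + 2.25 - 1.5 * c) *
        (2 * (3 * T - c) ^ 2 + 2 * (3 * c) * (3 * T - c) + (3 * c) ^ 2) := by
    rw [← hEq]; ring
  rw [e1, e2]
  obtain ⟨r, rfl⟩ : ∃ r, T = 1 + c + r := ⟨T - 1 - c, by ring⟩
  exact quartic_tail_bound hc hc2 (by linarith)

/-- The chord of exp over [-2, 0] lies above exp, which makes the left side at most an affine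
function of w. -/
theorem budget_of_add_le_one {t w : ℝ} (ht : 0 ≤ t) (hw0 : 0 ≤ w) (hw : w ≤ 1)
    (htw : 2 * w - 1 ≤ t) :
    1 + (Real.exp 2 - 1) / 2 * Real.exp (-(2 * (1 - w))) ≤ 2 * t + 2 + 2 * w := by
  have h2 := exp_two_le
  have hconv := convexOn_exp.2 (Set.mem_univ (0 : ℝ)) (Set.mem_univ (-2 : ℝ)) hw0
    (sub_nonneg.2 hw) (by ring)
  simp only [smul_eq_mul, mul_zero, zero_add, Real.exp_zero, mul_one] at hconv
  have h3 : Real.exp 2 * Real.exp (-2) = 1 := by rw [← Real.exp_add]; norm_num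
  have h4 : (Real.exp 2 - 1) / 2 * Real.exp (-(2 * (1 - w))) ≤
      (Real.exp 2 - 1) / 2 * (w + (1 - w) * Real.exp (-2)) := by
    have h5 : -(2 * (1 - w)) = (1 - w) * -2 := by ring
    rw [h5]
    have := Real.add_one_le_exp (2 : ℝ)
    gcongr
    linarith
  have h6 : (Real.exp 2 - 1) / 2 * (w + (1 - w) * Real.exp (-2)) =
      (Real.exp 2 - 1) / 2 * w + (1 - w) * (1 - Real.exp (-2)) / 2 := by
    linear_combination (1 - w) / 2 * h3
  have h7 : 0.135 ≤ Real.exp (-2) := by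
    rw [Real.exp_neg, le_inv_comm₀ (by norm_num) (Real.exp_pos _)]
    norm_num at h2 ⊢; linarith
  nlinarith [mul_nonneg hw0 (sub_nonneg.2 h2), mul_nonneg (sub_nonneg.2 hw) (sub_nonneg.2 h7)]

/-! ### The integral of exp g for β = 1 in three pieces. -/

section

open MeasureTheory Set Filter Topology

theorem continuous_balancedKernel (t : ℝ) {c : ℝ} (hc : 0 < c) :
    Continuous fun τ : ℝ => (2 * min (τ - t) c) / (c * max τ 1) := by
  refine Continuous.div (by fun_prop) (by fun_prop) fun τ => ?_
  have : (0 : ℝ) < max τ 1 := lt_max_of_lt_right one_pos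
  positivity

theorem balancedG_of_le {t c θ : ℝ} (h : max t 1 ≤ θ) :
    balancedG t c 1 θ = 2 / θ * (min (θ - t) c / c) -
      ∫ τ in t..θ, (2 * min (τ - t) c) / (c * max τ 1) := by
  simp [balancedG, not_lt.2 h]

theorem integral_balancedKernel_add {t c θ N : ℝ} (hc : 0 < c) (hN : max (t + c) 1 ≤ N)
    (hθ : N ≤ θ) :
    ∫ τ in t..θ, (2 * min (τ - t) c) / (c * max τ 1) =
      (∫ τ in t..N, (2 * min (τ - t) c) / (c * max τ 1)) + 2 * Real.log (θ / N) := by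
  have hk := continuous_balancedKernel t hc
  have hN1 : 1 ≤ N := (le_max_right _ _).trans hN
  have hNT : t + c ≤ N := (le_max_left _ _).trans hN
  rw [← intervalIntegral.integral_add_adjacent_intervals (hk.intervalIntegrable t N)
    (hk.intervalIntegrable N θ)]
  congr 1
  have : ∀ τ ∈ uIcc N θ, (2 * min (τ - t) c) / (c * max τ 1) = 2 * τ⁻¹ := by
    intro τ hτ
    rw [uIcc_of_le hθ] at hτ
    have h1 : min (τ - t) c = c := min_eq_right (by linarith [hτ.1])
    have h2 : max τ 1 = τ := max_eq_left (by linarith [hτ.1])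
    have : τ ≠ 0 := by linarith [hτ.1]
    rw [h1, h2]
    field_simp
  rw [intervalIntegral.integral_congr this, intervalIntegral.integral_const_mul,
    integral_inv_of_pos (by linarith) (by linarith)]

/-- Past N the kernel is 2/τ, so its integral contributes the factor (N/θ)². -/
theorem exp_balancedG_tail {t c θ N : ℝ} (hc : 0 < c) (hN : max (t + c) 1 ≤ N) (hθ : N ≤ θ) :
    Real.exp (balancedG t c 1 θ) =
      Real.exp (-∫ τ in t..N, (2 * min (τ - t) c) / (c * max τ 1)) * N ^ 2 *
        (Real.exp (2 / θ) / θ ^ 2) := by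
  have hN1 : 1 ≤ N := (le_max_right _ _).trans hN
  have hNT : t + c ≤ N := (le_max_left _ _).trans hN
  have hθ0 : 0 < θ := by linarith
  rw [balancedG_of_le (max_le (by linarith) (by linarith)),
    integral_balancedKernel_add hc hN hθ, min_eq_right (by linarith), div_self hc.ne', mul_one,
    sub_eq_add_neg, neg_add, Real.exp_add, Real.exp_add]
  have : Real.exp (-(2 * Real.log (θ / N))) = N ^ 2 / θ ^ 2 := by
    have h2 : 2 * Real.log (θ / N) = Real.log ((θ / N) ^ 2) := by
      rw [Real.log_pow]; norm_num
    rw [h2, Real.exp_neg, Real.exp_log (by positivity), div_pow, inv_div]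
  rw [this]
  field_simp

theorem integral_exp_two_div {N : ℝ} (hN : 0 < N) :
    IntegrableOn (fun θ : ℝ => Real.exp (2 / θ) / θ ^ 2) (Ioi N) ∧
      ∫ θ in Ioi N, Real.exp (2 / θ) / θ ^ 2 = (Real.exp (2 / N) - 1) / 2 := by
  have hd : ∀ x ∈ Ici N, HasDerivAt (fun θ : ℝ => -(Real.exp (2 / θ) / 2))
      (Real.exp (2 / x) / x ^ 2) x := by
    intro x hx
    have hx0 : x ≠ 0 := (hN.trans_le hx).ne'
    have h1 : HasDerivAt (fun θ : ℝ => 2 / θ) (2 * (-(x ^ 2)⁻¹)) x := by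
      simpa [div_eq_mul_inv] using (hasDerivAt_inv hx0).const_mul 2
    refine (h1.exp.div_const 2).neg.congr_deriv ?_
    field_simp
  have hp : ∀ x ∈ Ioi N, 0 ≤ Real.exp (2 / x) / x ^ 2 := fun x _ => by positivity
  have hl : Tendsto (fun θ : ℝ => -(Real.exp (2 / θ) / 2)) atTop (𝓝 (-(Real.exp 0 / 2))) :=
    (((Real.continuous_exp.tendsto 0).comp
      (tendsto_const_nhds.div_atTop tendsto_id)).div_const 2).neg
  refine ⟨integrableOn_Ioi_deriv_of_nonneg' hd hp hl, ?_⟩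
  rw [integral_Ioi_of_hasDerivAt_of_nonneg' hd hp hl, Real.exp_zero]
  ring

theorem continuousOn_balancedG (t : ℝ) {c : ℝ} (hc : 0 < c) :
    ContinuousOn (balancedG t c 1) (Ici (max t 1)) := by
  have hk := continuous_balancedKernel t hc
  have h : ContinuousOn (fun θ : ℝ => 2 / θ * (min (θ - t) c / c) -
      ∫ τ in t..θ, (2 * min (τ - t) c) / (c * max τ 1)) (Ici (max t 1)) := by
    refine ContinuousOn.sub (ContinuousOn.mul (continuousOn_const.div continuousOn_id ?_)
      (by fun_prop)) ?_
    · intro x hx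
      have : (1 : ℝ) ≤ x := (le_max_right t 1).trans hx
      simp; linarith
    · exact (intervalIntegral.continuous_primitive (fun a b => hk.intervalIntegrable a b)
        t).continuousOn
  exact h.congr fun θ hθ => balancedG_of_le hθ

theorem integral_exp_balancedG_le {t c p q : ℝ} (hc : 0 < c)
    (hb : ∀ θ ∈ Icc (max t 1) (max (t + c) 1),
      Real.exp (balancedG t c 1 θ) ≤ p - q * (θ - max t 1)) :
    IntegrableOn (fun θ : ℝ => Real.exp (balancedG t c 1 θ)) (Ioi 0) ∧
      ∫ θ in Ioi 0, Real.exp (balancedG t c 1 θ) ≤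
        max t 1 + (p * (max (t + c) 1 - max t 1) - q * (max (t + c) 1 - max t 1) ^ 2 / 2) +
        (Real.exp (2 / max (t + c) 1) - 1) / 2 * (max (t + c) 1) ^ 2 *
        Real.exp (-∫ τ in t..(max (t + c) 1), (2 * min (τ - t) c) / (c * max τ 1)) := by
  set M := max t 1 with hM
  set N := max (t + c) 1 with hN
  have hM1 : 1 ≤ M := le_max_right _ _
  have hMN : M ≤ N := max_le_max (by linarith) le_rfl
  set f := fun θ : ℝ => Real.exp (balancedG t c 1 θ) with hf
  have hf1 : EqOn f 1 (Ioo 0 M) := fun θ hθ => by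
    simp [hf, balancedG, ← hM, hθ.2]
  have hi1 : IntegrableOn f (Ioo 0 M) :=
    (integrableOn_const (C := (1 : ℝ)) (by simp)).congr_fun hf1.symm measurableSet_Ioo
  have hv1 : ∫ θ in Ioo 0 M, f θ = M := by
    rw [setIntegral_congr_fun measurableSet_Ioo hf1]
    simp; linarith
  have hc2 : ContinuousOn f (Icc M N) :=
    Real.continuous_exp.comp_continuousOn ((continuousOn_balancedG t hc).mono Icc_subset_Ici_self)
  have hi2 : IntegrableOn f (Icc M N) := hc2.integrableOn_Icc
  have hv2 : ∫ θ in Icc M N, f θ ≤ p * (N - M) - q * (N - M) ^ 2 / 2 := by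
    have hcont : Continuous fun θ : ℝ => p - q * (θ - M) := by fun_prop
    refine (setIntegral_mono_on hi2 hcont.continuousOn.integrableOn_Icc measurableSet_Icc
      hb).trans (le_of_eq ?_)
    rw [integral_Icc_eq_integral_Ioc, ← intervalIntegral.integral_of_le hMN,
      intervalIntegral.integral_eq_sub_of_hasDerivAt
        (f := fun θ => p * (θ - M) - q * (θ - M) ^ 2 / 2) _ (hcont.intervalIntegrable _ _)]
    · simp
    · intro x _
      have h := (hasDerivAt_id x).sub_const M
      refine ((h.const_mul p).sub (((h.pow 2).const_mul q).div_const 2)).congr_deriv ?_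
      simp; ring
  have hf3 : EqOn f (fun θ => Real.exp (-∫ τ in t..N, (2 * min (τ - t) c) / (c * max τ 1)) *
      N ^ 2 * (Real.exp (2 / θ) / θ ^ 2)) (Ioi N) := fun θ hθ =>
    exp_balancedG_tail hc le_rfl (le_of_lt hθ)
  obtain ⟨hi, hv⟩ := integral_exp_two_div (by linarith : 0 < N)
  have hi3 : IntegrableOn f (Ioi N) :=
    IntegrableOn.congr_fun (hi.const_mul _) hf3.symm measurableSet_Ioi
  have hv3 : ∫ θ in Ioi N, f θ = (Real.exp (2 / N) - 1) / 2 * N ^ 2 *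
      Real.exp (-∫ τ in t..N, (2 * min (τ - t) c) / (c * max τ 1)) := by
    rw [setIntegral_congr_fun measurableSet_Ioi hf3, integral_const_mul, hv]
    ring
  have hu1 : Icc M N ∪ Ioi N = Ici M := Icc_union_Ioi_eq_Ici hMN
  have hu : Ioo 0 M ∪ (Icc M N ∪ Ioi N) = Ioi 0 := by
    rw [hu1, Ioo_union_Ici_eq_Ioi (by linarith)]
  have hi4 := hi2.union hi3
  refine ⟨hu ▸ hi1.union hi4, ?_⟩
  rw [← hu, setIntegral_union _ (measurableSet_Icc.union measurableSet_Ioi) hi1 hi4,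
    setIntegral_union _ measurableSet_Ioi hi2 hi3, hv1, hv3]
  · linarith
  · exact Set.disjoint_left.2 fun x hx hx' => not_lt.2 hx.2 hx'
  · rw [hu1]; exact Set.disjoint_left.2 fun x hx hx' => not_lt.2 hx' hx.2

/-! ### Closed forms for the kernel integrals and the tail factor. -/

theorem integral_balancedKernel_ramp {t c a θ : ℝ} (hc : 0 < c) (ha : max t 1 ≤ a)
    (hθ : a ≤ θ) (hθT : θ ≤ t + c) :
    ∫ τ in a..θ, (2 * min (τ - t) c) / (c * max τ 1) =
      2 / c * (θ - a - t * Real.log (θ / a)) := by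
  have h1a : 1 ≤ a := (le_max_right _ _).trans ha
  have : ∀ τ ∈ uIcc a θ, (2 * min (τ - t) c) / (c * max τ 1) = 2 / c * (1 - t * τ⁻¹) := by
    intro τ hτ
    rw [uIcc_of_le hθ] at hτ
    have h1 : min (τ - t) c = τ - t := min_eq_left (by linarith [hτ.2])
    have h2 : max τ 1 = τ := max_eq_left (by linarith [hτ.1])
    have : τ ≠ 0 := by linarith [hτ.1]
    rw [h1, h2]
    field_simp
  rw [intervalIntegral.integral_congr this, intervalIntegral.integral_const_mul,
    intervalIntegral.integral_sub (by simp), intervalIntegral.integral_const_mul,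
    integral_inv_of_pos (by linarith) (by linarith)]
  · simp
  · refine (ContinuousOn.intervalIntegrable fun x hx => ?_).const_mul t
    rw [uIcc_of_le hθ] at hx
    exact (continuousAt_inv₀ (by linarith [hx.1])).continuousWithinAt

theorem integral_min_div_of_le {t c b : ℝ} (hb : t ≤ b) (hbc : b ≤ t + c) :
    ∫ τ in t..b, min (τ - t) c / c = (b - t) ^ 2 / (2 * c) := by
  have : ∀ τ ∈ uIcc t b, min (τ - t) c / c = (τ - t) / c := by
    intro τ hτ
    rw [uIcc_of_le hb] at hτ
    rw [min_eq_left (by linarith [hτ.2])]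
  rw [intervalIntegral.integral_congr this, intervalIntegral.integral_div,
    intervalIntegral.integral_comp_sub_right (fun x => x), integral_id]
  simp
  ring

theorem integral_min_div_of_ge {t c b : ℝ} (hc : 0 < c) (hb : t + c ≤ b) :
    ∫ τ in t..b, min (τ - t) c / c = b - t - c / 2 := by
  have hk : Continuous fun τ : ℝ => min (τ - t) c / c := by fun_prop
  rw [← intervalIntegral.integral_add_adjacent_intervals (hk.intervalIntegrable t (t + c))
    (hk.intervalIntegrable (t + c) b), integral_min_div_of_le (by linarith) le_rfl]
  have : ∀ τ ∈ uIcc (t + c) b, min (τ - t) c / c = 1 := by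
    intro τ hτ
    rw [uIcc_of_le hb] at hτ
    rw [min_eq_right (by linarith [hτ.1]), div_self hc.ne']
  rw [intervalIntegral.integral_congr this]
  simp
  field_simp
  ring

theorem integral_balancedKernel_le_one {t c : ℝ} (ht : t ≤ 1) :
    ∫ τ in t..1, (2 * min (τ - t) c) / (c * max τ 1) = 2 * ∫ τ in t..1, min (τ - t) c / c := by
  rw [← intervalIntegral.integral_const_mul]
  refine intervalIntegral.integral_congr fun τ hτ => ?_
  rw [uIcc_of_le ht] at hτ
  simp only [max_eq_right hτ.2]
  ring

theorem tail_factor_le_cubic {N : ℝ} (hN : 1 ≤ N) :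
    (Real.exp (2 / N) - 1) / 2 * N ^ 2 ≤ N + 1 + 1.196 / N := by
  have hN0 : 0 < N := by linarith
  have h := exp_le_cubic (x := 2 / N) (by positivity) (by rw [div_le_iff₀ hN0]; linarith)
  have h2 : (Real.exp (2 / N) - 1) / 2 * N ^ 2 ≤
      (2 / N + (2 / N) ^ 2 / 2 + 0.299 * (2 / N) ^ 3) / 2 * N ^ 2 := by
    gcongr; linarith
  refine h2.trans (le_of_eq ?_)
  field_simp
  ring

theorem balancedF_nonneg_of_integral_le {t c β B : ℝ}
    (h : IntegrableOn (fun θ : ℝ => Real.exp (balancedG t c β θ)) (Ioi 0) ∧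
      ∫ θ in Ioi 0, Real.exp (balancedG t c β θ) ≤ B)
    (hB : 2 * B ≤ 4 * t + 8 * β - balancedH t c β) :
    IntegrableOn (fun θ : ℝ => Real.exp (balancedG t c β θ)) (Ioi 0) ∧ 0 ≤ balancedF t c β := by
  refine ⟨h.1, ?_⟩
  have := h.2
  unfold balancedF
  linarith

/-! ### The three regimes for β = 1. -/

theorem balancedF_nonneg_of_one_le {t c : ℝ} (hc : 0 < c) (hc2 : c ≤ 2) (ht : 1 ≤ t) :
    IntegrableOn (fun θ : ℝ => Real.exp (balancedG t c 1 θ)) (Ioi 0) ∧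
      0 ≤ balancedF t c 1 := by
  have hM : max t 1 = t := max_eq_left ht
  have hN : max (t + c) 1 = t + c := max_eq_left (by linarith)
  have ht0 : 0 < t := by linarith
  -- With s = θ - t, the exponent is at most (2s - s²) / (cθ). Dropping s² gives 2 / (t + c) ≤ 2 /
  -- (1 + c); maximising (2s - s²) / (1 + s) gives 4 - 2√3 < 0.54, attained at s = √3 - 1 ≈ 0.73.
  set y := min (2 / (1 + c)) (0.54 / c) with hy
  have key : ∀ θ ∈ Icc (max t 1) (max (t + c) 1),
      Real.exp (balancedG t c 1 θ) ≤ Real.exp y - 0 * (θ - max t 1) := by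
    intro θ hθ
    have hθ' := hθ
    rw [hM, hN] at hθ
    rw [zero_mul, sub_zero]
    refine Real.exp_le_exp.2 ?_
    have hθ0 : 0 < θ := by linarith [hθ.1]
    have hr : 1 ≤ θ / t := by rw [le_div_iff₀ ht0]; linarith [hθ.1]
    rw [balancedG_of_le hθ'.1, integral_balancedKernel_ramp hc hM.le hθ.1 hθ.2,
      min_eq_left (by linarith [hθ.2])]
    have hl := log_le_half_sub_inv hr
    have hl2 : t * Real.log (θ / t) ≤ (θ ^ 2 - t ^ 2) / (2 * θ) := by
      refine (mul_le_mul_of_nonneg_left hl ht0.le).trans (le_of_eq ?_)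
      field_simp
    have hg : 2 / θ * ((θ - t) / c) - 2 / c * (θ - t - t * Real.log (θ / t)) ≤
        (2 * (θ - t) - (θ - t) ^ 2) / (c * θ) := by
      calc _ ≤ 2 / θ * ((θ - t) / c) - 2 / c * (θ - t - (θ ^ 2 - t ^ 2) / (2 * θ)) := by gcongr
        _ = _ := by field_simp; ring
    refine hg.trans (le_min ?_ ?_)
    · rw [div_le_div_iff₀ (by positivity) (by positivity)]
      nlinarith [mul_nonneg (sub_nonneg.2 hθ.1) hc.le, mul_nonneg (sub_nonneg.2 hθ.2) ht0.le,
        mul_nonneg (sq_nonneg (θ - t)) (by linarith : 0 ≤ 1 + c),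
        mul_nonneg (sub_nonneg.2 ht) hc.le]
    · rw [div_le_div_iff₀ (by positivity) (by positivity)]
      nlinarith [mul_nonneg hc.le (sq_nonneg ((θ - t) - 0.73)), mul_nonneg (sub_nonneg.2 ht) hc.le]
  have hI := integral_exp_balancedG_le hc key
  rw [hM, hN, integral_balancedKernel_ramp hc hM.le (by linarith) le_rfl] at hI
  refine balancedF_nonneg_of_integral_le hI ?_
  have hH : balancedH t c 1 = 0 := by simp [balancedH, min_eq_right ht]
  -- The case d = 0, w = c bounds the middle by 1.75 + 0.5 c. With the initial t and the tail bound
  -- t + 2.25 - 0.5 c, the sum is exactly the allowed 2t + 4.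
  have h1 := mul_exp_le_of_le_half (d := 0) (w := c) (y := y) le_rfl (by norm_num) hc.le
    (by linarith) (min_le_left _ _) (by
      have : y ≤ 0.54 / c := min_le_right _ _
      rw [le_div_iff₀ hc] at this
      linarith)
  have hD : 3 * c / (3 * (t + c) - c) ≤ 2 / c * (t + c - t - t * Real.log ((t + c) / t)) := by
    have hl := log_le_pade (x := (t + c) / t) (by rw [le_div_iff₀ ht0]; linarith)
    have hl2 : t * Real.log ((t + c) / t) ≤ c * (6 * t + c) / (6 * t + 4 * c) := by
      refine (mul_le_mul_of_nonneg_left hl ht0.le).trans (le_of_eq ?_)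
      field_simp
      ring
    calc _ = 2 / c * (t + c - t - c * (6 * t + c) / (6 * t + 4 * c)) := by
          have : 3 * (t + c) - c = 3 * t + 2 * c := by ring
          rw [this]
          field_simp
          ring
      _ ≤ _ := by gcongr
  have h2 := tail_le_of_one_le hc hc2 (by linarith : 1 + c ≤ t + c) hD
  have h3 := mul_le_mul_of_nonneg_right (tail_factor_le_cubic (by linarith : 1 ≤ t + c))
    (Real.exp_pos (-(2 / c * (t + c - t - t * Real.log ((t + c) / t))))).le
  rw [hH]
  linarith

theorem balancedF_nonneg_of_add_le_one {t c : ℝ} (ht : 0 < t) (hc : 0 < c) (htc : t + c ≤ 1) :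
    IntegrableOn (fun θ : ℝ => Real.exp (balancedG t c 1 θ)) (Ioi 0) ∧
      0 ≤ balancedF t c 1 := by
  have hM : max t 1 = 1 := max_eq_right (by linarith)
  have hN : max (t + c) 1 = 1 := max_eq_right htc
  have key : ∀ θ ∈ Icc (max t 1) (max (t + c) 1),
      Real.exp (balancedG t c 1 θ) ≤ Real.exp (balancedG t c 1 1) - 0 * (θ - max t 1) := by
    intro θ hθ
    rw [hM, hN] at hθ
    rw [le_antisymm hθ.2 hθ.1]; simp
  have hI := integral_exp_balancedG_le hc key
  have hi := integral_min_div_of_ge hc htc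
  rw [hM, hN, integral_balancedKernel_le_one (by linarith), hi] at hI
  refine balancedF_nonneg_of_integral_le hI ?_
  have hH : balancedH t c 1 = 4 * (1 - t - c / 2) := by
    rw [balancedH, min_eq_left (by linarith), hi]
  have h := budget_of_add_le_one (t := t) (w := t + c / 2) ht.le (by positivity) (by linarith)
    (by linarith)
  have e : -(2 * (1 - (t + c / 2))) = -(2 * (1 - t - c / 2)) := by ring
  rw [e] at h
  rw [hH]
  norm_num at h ⊢
  linarith

/-- The difference of the sides is a quadratic in θ with leading coefficient 1 + d > 0 and
nonpositive discriminant. At d = 0 the sharp constant is 4 - 2√3, rounded up to 0.54. -/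
theorem ramp_numerator_le {d : ℝ} (hd : 0 ≤ d) (hd2 : d ≤ 1 / 2) (θ : ℝ) :
    2 * (θ - (1 - d)) - d ^ 2 * θ - 2 * (θ - 1) * θ + (1 - d) * (θ ^ 2 - 1) ≤
      (0.54 + 0.86 * d ^ 2) * θ := by
  have hdisc : (3.46 - 1.86 * d ^ 2) ^ 2 ≤ 12 * (1 - d ^ 2) := by
    nlinarith [mul_nonneg (sq_nonneg d) (by nlinarith : 0 ≤ 1 / 4 - d ^ 2)]
  have hpos : 0 < 4 * (1 + d) := by linarith
  have hsq : 4 * (1 + d) * ((1 + d) * θ ^ 2 - (3.46 - 1.86 * d ^ 2) * θ + 3 * (1 - d)) =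
      (2 * (1 + d) * θ - (3.46 - 1.86 * d ^ 2)) ^ 2 +
        (12 * (1 - d ^ 2) - (3.46 - 1.86 * d ^ 2) ^ 2) := by ring
  have h0 : 0 ≤ 4 * (1 + d) *
      ((1 + d) * θ ^ 2 - (3.46 - 1.86 * d ^ 2) * θ + 3 * (1 - d)) := by
    rw [hsq]
    linarith [sq_nonneg (2 * (1 + d) * θ - (3.46 - 1.86 * d ^ 2))]
  linarith [nonneg_of_mul_nonneg_right h0 hpos]

set_option maxHeartbeats 1000000 in
theorem balancedF_nonneg_of_lt_one {t c : ℝ} (ht : 0 < t) (hc2 : c ≤ 2) (ht1 : t < 1)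
    (htc : 1 < t + c) :
    IntegrableOn (fun θ : ℝ => Real.exp (balancedG t c 1 θ)) (Ioi 0) ∧
      0 ≤ balancedF t c 1 := by
  have hc : 0 < c := by linarith
  have hM : max t 1 = 1 := max_eq_right ht1.le
  have hN : max (t + c) 1 = t + c := max_eq_left htc.le
  have hi := integral_min_div_of_le (c := c) ht1.le htc.le
  have hP : ∀ θ, 1 ≤ θ → θ ≤ t + c → ∫ τ in t..θ, (2 * min (τ - t) c) / (c * max τ 1) =
      ((1 - t) ^ 2 + 2 * (θ - 1 - t * Real.log θ)) / c := by
    intro θ h1 h2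
    have hk := continuous_balancedKernel t hc
    rw [← intervalIntegral.integral_add_adjacent_intervals (hk.intervalIntegrable t 1)
      (hk.intervalIntegrable 1 θ), integral_balancedKernel_le_one ht1.le, hi,
      integral_balancedKernel_ramp hc hM.le h1 h2, div_one]
    field_simp
  have hH : balancedH t c 1 = 2 * (1 - t) ^ 2 / c := by
    rw [balancedH, min_eq_left ht1.le, hi]
    field_simp
    ring
  -- The coordinates are d = 1 - t and w = t + c - 1: the parts of the ramp before and after θ = 1.
  obtain ⟨d, rfl⟩ : ∃ d, t = 1 - d := ⟨1 - t, by ring⟩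
  obtain ⟨w, rfl⟩ : ∃ w, c = d + w := ⟨c - d, by ring⟩
  have hd : 0 < d := by linarith
  have hd1 : d ≤ 1 := by linarith
  have hw : 0 < w := by linarith
  have hwd : w ≤ 2 - d := by linarith
  have hT : 1 - d + (d + w) = 1 + w := by ring
  have hg : ∀ θ, 1 ≤ θ → θ ≤ 1 + w → balancedG (1 - d) (d + w) 1 θ =
      2 / θ * ((θ - (1 - d)) / (d + w)) -
        (d ^ 2 + 2 * (θ - 1 - (1 - d) * Real.log θ)) / (d + w) := by
    intro θ h1 h2
    rw [balancedG_of_le (hM.le.trans h1), hP θ h1 (by linarith), min_eq_left (by linarith)]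
    ring_nf
  have htail : (Real.exp (2 / (1 + w)) - 1) / 2 * (1 + w) ^ 2 *
      Real.exp (-((d ^ 2 + 2 * (1 + w - 1 - (1 - d) * Real.log (1 + w))) / (d + w))) ≤
      (1 - 0.9 * d + 0.28 * d ^ 2) * (3.2 - 0.6 * w) := by
    have hD : d + 0.4 * w ≤
        (d ^ 2 + 2 * (1 + w - 1 - (1 - d) * Real.log (1 + w))) / (d + w) := by
      have hl := mul_le_mul_of_nonneg_left (log_le_pade (x := 1 + w) (by linarith)) ht.le
      -- This shape makes the numerator at least d² + 1.4 d w + 0.4 w² = (d + w)(d + 0.4 w).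
      have hl2 : (1 - d) * ((1 + w - 1) * (1 + w + 5) / (4 * (1 + w) + 2)) ≤
          w * (1 - 0.7 * d - 0.2 * w) := by
        rw [← mul_div_assoc, div_le_iff₀ (by linarith)]
        have : 0 ≤ 0.4 * w + 3.6 * d - 2 * d * w := by
          nlinarith [mul_nonneg hd.le (sub_nonneg.2 hwd), mul_nonneg hd.le hw.le]
        nlinarith [mul_nonneg hw.le this, mul_nonneg (mul_nonneg hw.le hw.le) (sub_nonneg.2 hwd)]
      rw [le_div_iff₀ hc]
      nlinarith
    have h1 : Real.exp (-((d ^ 2 + 2 * (1 + w - 1 - (1 - d) * Real.log (1 + w))) / (d + w))) ≤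
        Real.exp (-d) * Real.exp (-(0.4 * w)) := by
      rw [← Real.exp_add]
      exact Real.exp_le_exp.2 (by linarith)
    have h2 := tail_factor_le_cubic (by linarith : 1 ≤ 1 + w)
    have h3 := tail_factor_le hw.le (by linarith : w ≤ 2)
    have h4 := exp_neg_le hd.le hd1
    calc _ ≤ (1 + w + 1 + 1.196 / (1 + w)) * (Real.exp (-d) * Real.exp (-(0.4 * w))) := by
          gcongr
      _ = Real.exp (-d) * ((2 + w + 1.196 / (1 + w)) * Real.exp (-(0.4 * w))) := by ring
      _ ≤ Real.exp (-d) * (3.2 - 0.6 * w) := by gcongr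
      _ ≤ _ := by
        have : 0 ≤ 3.2 - 0.6 * w := by linarith
        gcongr
  have fin : ∀ p q : ℝ, (∀ θ, 1 ≤ θ → θ ≤ 1 + w →
      Real.exp (balancedG (1 - d) (d + w) 1 θ) ≤ p - q * (θ - 1)) →
      p * w - q * w ^ 2 / 2 + (1 - 0.9 * d + 0.28 * d ^ 2) * (3.2 - 0.6 * w) ≤
        5 - 2 * d - d ^ 2 / (d + w) →
      IntegrableOn (fun θ : ℝ => Real.exp (balancedG (1 - d) (d + w) 1 θ)) (Ioi 0) ∧
        0 ≤ balancedF (1 - d) (d + w) 1 := by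
    intro p q hb hbud
    have hI := integral_exp_balancedG_le (p := p) (q := q) hc (t := 1 - d) (by
      rw [hM, hN, hT]
      exact fun θ hθ => hb θ hθ.1 hθ.2)
    have e1 : 1 - (1 - d) = d := by ring
    have e2 : 1 + w - 1 = w := by ring
    have e3 : 2 * d ^ 2 / (d + w) = 2 * (d ^ 2 / (d + w)) := by ring
    rw [e2] at htail
    rw [hM, hN, hP _ htc.le le_rfl, hT, e1, e2] at hI
    refine balancedF_nonneg_of_integral_le hI ?_
    rw [hH, e1, e3]
    linarith
  rcases le_total d (1 / 2) with h | h
  · set y := min (2 / (1 + w)) ((0.54 + 0.86 * d ^ 2) / (d + w)) with hy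
    refine fin (Real.exp y) 0 (fun θ h1 h2 => ?_) ?_
    · rw [zero_mul, sub_zero, hg θ h1 h2]
      refine Real.exp_le_exp.2 ?_
      have hθ : 0 < θ := by linarith
      have hl := log_le_half_sub_inv h1
      have hb : 2 / θ * ((θ - (1 - d)) / (d + w)) -
          (d ^ 2 + 2 * (θ - 1 - (1 - d) * Real.log θ)) / (d + w) ≤
          (2 * (θ - (1 - d)) - d ^ 2 * θ - 2 * (θ - 1) * θ + (1 - d) * (θ ^ 2 - 1)) /
            ((d + w) * θ) := by
        calc _ ≤ 2 / θ * ((θ - (1 - d)) / (d + w)) -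
            (d ^ 2 + 2 * (θ - 1 - (1 - d) * ((θ ^ 2 - 1) / (2 * θ)))) / (d + w) := by gcongr
          _ = _ := by field_simp; ring
      refine hb.trans (le_min ?_ ?_)
      · rw [div_le_div_iff₀ (by positivity) (by positivity)]
        have i1 : 0 ≤ d ^ 2 * θ + 2 * (θ - 1) * θ - (1 - d) * (θ ^ 2 - 1) := by
          nlinarith [mul_nonneg hd.le hθ.le, mul_nonneg (sub_nonneg.2 h1) hθ.le,
            mul_nonneg (sub_nonneg.2 h1) (sub_nonneg.2 h1), mul_nonneg (sub_nonneg.2 h1) hd.le,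
            mul_nonneg hd.le (mul_nonneg (sub_nonneg.2 h1) hθ.le)]
        nlinarith [mul_nonneg i1 (by linarith : 0 ≤ 1 + w), mul_nonneg ht.le (sub_nonneg.2 h2)]
      · rw [div_le_div_iff₀ (by positivity) (by positivity)]
        have i2 := ramp_numerator_le hd.le h θ
        linarith [mul_le_mul_of_nonneg_right i2 hc.le]
    · have h1 := mul_exp_le_of_le_half (y := y) hd.le h hw.le hwd (min_le_left _ _) (by
        have : y ≤ (0.54 + 0.86 * d ^ 2) / (d + w) := min_le_right _ _
        rw [le_div_iff₀ hc] at this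
        linarith)
      have := budget_of_le_half hd.le h hw hwd
      linarith
  -- Here a is the value and -b the slope of g at θ = 1. On the ramp g is concave, so its tangent
  -- line bounds it; the slope is nonpositive exactly when d ≥ 1/2.
  · set b := (4 * d - 2) / (d + w) with hb
    set a := (2 * d - d ^ 2) / (d + w) with ha
    have hb0 : 0 ≤ b := div_nonneg (by linarith) hc.le
    refine fin (Real.exp a) (0.62 * b * Real.exp a) (fun θ h1 h2 => ?_) ?_
    · have hθ : 0 < θ := by linarith
      have hz : b * (θ - 1) ≤ 1 := by
        rw [hb, div_mul_eq_mul_div, div_le_one hc]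
        nlinarith
      have hz0 : 0 ≤ b * (θ - 1) := mul_nonneg hb0 (by linarith)
      have e1 : Real.exp (balancedG (1 - d) (d + w) 1 θ) ≤ Real.exp (a + -(b * (θ - 1))) := by
        refine Real.exp_le_exp.2 ?_
        rw [hg θ h1 h2]
        have hl := Real.log_le_sub_one_of_pos hθ
        have : 2 / θ * ((θ - (1 - d)) / (d + w)) = 2 * (1 - (1 - d) / θ) / (d + w) := by
          field_simp
        rw [this, hb, ha, ← sub_div, ← sub_eq_add_neg, div_mul_eq_mul_div, ← sub_div]
        refine div_le_div_of_nonneg_right ?_ hc.le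
        have hinv : 1 - (θ - 1) ≤ 1 / θ := by
          rw [le_div_iff₀ hθ]; nlinarith [sq_nonneg (θ - 1)]
        have e3 : (1 - d) / θ = (1 - d) * (1 / θ) := by ring
        rw [e3]
        nlinarith [mul_le_mul_of_nonneg_left hl ht.le, mul_le_mul_of_nonneg_left hinv ht.le]
      rw [Real.exp_add] at e1
      have e2 := exp_neg_le hz0 hz
      -- For z in [0, 1], 0.28 z² ≤ 0.28 z turns the quadratic bound into 1 - 0.62 z.
      have e3 : Real.exp (-(b * (θ - 1))) ≤ 1 - 0.62 * (b * (θ - 1)) := by nlinarith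
      nlinarith [mul_le_mul_of_nonneg_left e3 (Real.exp_pos a).le]
    · have h1 := mul_exp_le_of_half_le h hd1 hw.le hwd
      have := budget_of_half_le h hd1 hw hwd
      rw [← ha, ← hb] at h1
      linarith

end

/-! ### Homogeneity and reduction to β = 1. -/

theorem balancedH_mul {k : ℝ} (hk : 0 < k) (t c β : ℝ) :
    balancedH (k * t) (k * c) (k * β) = k * balancedH t c β := by
  have h := intervalIntegral.mul_integral_comp_mul_left
    (f := fun τ => min (τ - k * t) (k * c) / (k * c)) (a := min t β) (b := β) k
  rw [balancedH, balancedH, ← mul_min_of_nonneg _ _ hk.le, ← h, mul_left_comm]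
  congr 3
  funext τ
  rw [← mul_sub, ← mul_min_of_nonneg _ _ hk.le, mul_div_mul_left _ _ hk.ne']

theorem balancedG_mul {k : ℝ} (hk : 0 < k) (t c β θ : ℝ) :
    balancedG (k * t) (k * c) (k * β) (k * θ) = balancedG t c β θ := by
  have h := intervalIntegral.mul_integral_comp_mul_left
    (f := fun τ => (2 * min (τ - k * t) (k * c)) / (k * c * max τ (k * β))) (a := t) (b := θ) k
  rw [balancedG, balancedG, ← mul_max_of_nonneg _ _ hk.le, ← h,
    ← intervalIntegral.integral_const_mul]
  simp only [mul_lt_mul_iff_right₀ hk]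
  congr 2
  · rw [← mul_sub, ← mul_min_of_nonneg _ _ hk.le, mul_div_mul_left _ _ hk.ne',
      mul_left_comm 2 k β, mul_div_mul_left _ _ hk.ne']
  · congr 1
    funext τ
    rw [← mul_sub, ← mul_min_of_nonneg _ _ hk.le, ← mul_max_of_nonneg _ _ hk.le]
    rw [show k * (2 * (k * min (τ - t) c) / (k * c * (k * max τ β))) =
      (k * k * (2 * min (τ - t) c)) / (k * k * (c * max τ β)) by ring,
      mul_div_mul_left _ _ (mul_pos hk hk).ne']

theorem balancedF_mul {k : ℝ} (hk : 0 < k) (t c β : ℝ) :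
    balancedF (k * t) (k * c) (k * β) = k * balancedF t c β := by
  have h := MeasureTheory.integral_comp_mul_left_Ioi
    (fun θ => Real.exp (balancedG (k * t) (k * c) (k * β) θ)) 0 hk
  simp only [balancedG_mul hk, mul_zero, smul_eq_mul] at h
  rw [balancedF, balancedF, balancedH_mul hk, h]
  field_simp

theorem integrableOn_exp_balancedG_mul {k : ℝ} (hk : 0 < k) {t c β : ℝ}
    (h : MeasureTheory.IntegrableOn (fun θ : ℝ => Real.exp (balancedG t c β θ)) (Set.Ioi 0)) :
    MeasureTheory.IntegrableOn
      (fun θ : ℝ => Real.exp (balancedG (k * t) (k * c) (k * β) θ)) (Set.Ioi 0) := by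
  have := MeasureTheory.integrableOn_Ioi_comp_mul_left_iff
    (fun θ => Real.exp (balancedG (k * t) (k * c) (k * β) θ)) 0 hk
  simp only [balancedG_mul hk, mul_zero] at this
  exact this.1 h

theorem mainTheorem2 (t c β : ℝ) (ht : 0 < t) (hc : 0 < c) (hβ : c / 2 ≤ β) :
    MeasureTheory.IntegrableOn (fun θ : ℝ => Real.exp (balancedG t c β θ)) (Set.Ioi (0 : ℝ)) ∧
      0 ≤ balancedF t c β := by
  have hβ0 : 0 < β := by linarith
  have ht' : 0 < t / β := by positivity
  have hc' : 0 < c / β := by positivity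
  have hc2 : c / β ≤ 2 := by rw [div_le_iff₀ hβ0]; linarith
  have key : MeasureTheory.IntegrableOn
      (fun θ : ℝ => Real.exp (balancedG (t / β) (c / β) 1 θ)) (Set.Ioi (0 : ℝ)) ∧
      0 ≤ balancedF (t / β) (c / β) 1 := by
    rcases le_or_gt 1 (t / β) with h | h
    · exact balancedF_nonneg_of_one_le hc' hc2 h
    rcases le_or_gt (t / β + c / β) 1 with h' | h'
    · exact balancedF_nonneg_of_add_le_one ht' hc' h'
    · exact balancedF_nonneg_of_lt_one ht' hc2 h h'
  have e1 : β * (t / β) = t := mul_div_cancel₀ t hβ0.ne'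
  have e2 : β * (c / β) = c := mul_div_cancel₀ c hβ0.ne'
  have hI := integrableOn_exp_balancedG_mul hβ0 key.1
  have hF := balancedF_mul hβ0 (t / β) (c / β) 1
  rw [e1, e2, mul_one] at hI hF
  exact ⟨hI, hF ▸ mul_nonneg hβ0.le key.2⟩
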